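/- Let $d>0$ and $K>0$, and let $b,\tau:[0,\infty)\to[0,\infty)$ satisfy (derivatives at $0$ are one-sided): * (B) $b(0)=0$, $b(K)=dK$, $b(u)>du$ for $0<u<K$, and $0<b(u)<du$ for $u>K$; * (A) $\tau\in C^1([0,\infty))$, $0\le\tau'(u)<1$ for all $u\ge 0$, and $\lim_{u\to\infty}\tau(u)=M<\infty$; put $m=\tau(0)$; * (C1) $b\in C^1([0,\infty))$; * (C2) $b'(0)>d$, and $b(u)<b'(0)u$ for all $u>0$; * (C3) there is $L>0$ such that $0\le b'(0)u-b(u)<Lu^2$ for $0<u\le K$; moreover $|b'(u)|\le b'(0)$ for $0\le u\le K$. The function $b$ is not assumed to be monotone. For $\lambda,c\ge 0$ let $$\Lambda(\lambda,c)=\lambda^2-c\lambda-d+b'(0)e^{-\lambda cm},$$ and let $c^*=\inf\{c>0:\Lambda(\lambda,c)=0\text{ for some }\lambda>0\}$. (Thus $c^*>0$, $\Lambda(\cdot,c)>0$ on $[0,\infty)$ for $0\le c<c^*$, and $\Lambda(\cdot,c)$ has two distinct positive zeros for $c>c^*$.) Then for every $c>c^*$ there is a bounded function $\phi\in C^2(\mathbb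 R)$ with $\phi(\xi)>0$ for all $\xi\in\mathbb R$, $$\phi''(\xi)-c\,\phi'(\xi)-d\,\phi(\xi)+b\bigl(\phi(\xi-c\,\tau(\phi(\xi)))\bigr)=0,\qquad \xi\in\mathbb R,$$ $$\lim_{\xi\to-\infty}\phi(\xi)=0,\qquad \liminf_{\xi\to+\infty}\phi(\xi)>0.$$ -/

import Mathlib

open Set Filter Topology

namespace StateDelayWave

/-- The value `f'(u)` of a function on `[0, ∞)` (one-sided at `u = 0`). -/
noncomputable def halfDeriv (f : ℝ → ℝ) (u : ℝ) : ℝ := derivWithin f (Ici 0) u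

/-- The standing assumption on the birth function `b : [0, ∞) → [0, ∞)` with death rate `d`
and positive equilibrium `K`. Only the values of `b` on `[0, ∞)` are constrained. -/
structure IsBirthFunction (d K : ℝ) (b : ℝ → ℝ) : Prop where
  nonneg : ∀ u, 0 ≤ u → 0 ≤ b u
  zero : b 0 = 0
  equilibrium : b K = d * K
  gt_below : ∀ u, 0 < u → u < K → d * u < b u
  pos_above : ∀ u, K < u → 0 < b u
  lt_above : ∀ u, K < u → b u < d * u

/-- The assumptions on the state-dependent delay `τ : [0, ∞) → [0, ∞)`, whose limit at infinity
is the real number `M`. -/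
structure IsDelay (M : ℝ) (τ : ℝ → ℝ) : Prop where
  contDiffOn : ContDiffOn ℝ 1 τ (Ici 0)
  nonneg : ∀ u, 0 ≤ u → 0 ≤ τ u
  deriv_nonneg : ∀ u, 0 ≤ u → 0 ≤ halfDeriv τ u
  deriv_lt_one : ∀ u, 0 ≤ u → halfDeriv τ u < 1
  tendsto : Tendsto τ atTop (𝓝 M)

/-- The smoothness and growth assumptions on a birth function that need not be monotone. The strict
inequalities are required at `u > 0`, since both of their sides vanish at `u = 0`. -/
structure IsNonmonotoneBirth (d K : ℝ) (b : ℝ → ℝ) : Prop where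
  contDiffOn : ContDiffOn ℝ 1 b (Ici 0)
  deriv_zero_gt : d < halfDeriv b 0
  lt_linear : ∀ u, 0 < u → b u < halfDeriv b 0 * u
  quadratic : ∃ L : ℝ, 0 < L ∧ ∀ u, 0 < u → u ≤ K →
    0 ≤ halfDeriv b 0 * u - b u ∧ halfDeriv b 0 * u - b u < L * u ^ 2
  abs_deriv_le : ∀ u, 0 ≤ u → u ≤ K → |halfDeriv b u| ≤ halfDeriv b 0

/-- The characteristic function `Λ(λ, c) = λ² - c λ - d + p e^{-λ c m}` of the linearization
at `0`, where `p = b'(0)` and `m = τ(0)`: it is what `e^{λ ξ}` gives when it is inserted in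
`φ''(ξ) - c φ'(ξ) - d φ(ξ) + p φ(ξ - c m)` and `e^{λ ξ}` is divided out. -/
noncomputable def charFun (d p m lam c : ℝ) : ℝ :=
  lam ^ 2 - c * lam - d + p * Real.exp (-(lam * c * m))

/-- The threshold speed `c*`: the infimum of the speeds `c > 0` for which `Λ(·, c)` has a
positive zero. -/
noncomputable def criticalSpeed (d p m : ℝ) : ℝ :=
  sInf {c : ℝ | 0 < c ∧ ∃ lam : ℝ, 0 < lam ∧ charFun d p m lam c = 0}

/-- `φ` is a `C²` solution on all of `ℝ` of
`φ''(ξ) - c φ'(ξ) - d φ(ξ) + b(φ(ξ - c τ(φ(ξ)))) = 0`. -/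
structure IsWaveProfile (d : ℝ) (b τ : ℝ → ℝ) (c : ℝ) (φ : ℝ → ℝ) : Prop where
  contDiff : ContDiff ℝ 2 φ
  equation : ∀ ξ, deriv (deriv φ) ξ - c * deriv φ ξ - d * φ ξ + b (φ (ξ - c * τ (φ ξ))) = 0

end StateDelayWave

namespace StateDelayWave

/-! ### Generic real analysis -/

/-! The delay and the birth term are evaluated not at `φ` but at its truncation between a lower and
an upper barrier. The truncated equation has a bounded continuous source and a bounded solution on
the line; comparison then puts this solution between the barriers, where the truncation does
nothing. No circularity arises, since the comparison uses only bounds that every truncated value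
satisfies.

Existence (`exists_bounded_solution`) needs no fixed point theorem. Write D² - cD - d = (D + α)(D -
β) with α, β > 0, i.e. φ' = βφ + v, v' = -αv - H. On [-R, R] an artificial extra delay ε makes the
source depend only on the past, so the method of steps solves the initial value problem, and
shooting gives φ(R) = 0. The bounds depend on neither R nor ε; Arzelà–Ascoli allows R → ∞, ε → 0.

The upper barriers are a constant k with b ≤ dk on [0, k], and e^{lx} with Λ(l, c) = 0, by b(u) ≤
b'(0)u and τ ≥ m. The lower barrier is e^{lx} - q e^{νx} up to its maximum z and constant
afterwards, with l < ν ≤ 2l and Λ(ν, c) < 0. Since τ(u) ≤ m + u, state dependence lengthens the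
delay by at most c e^{lx}. This and the nonlinearity of b cost O(e^{2lx}), which the e^{νx} term
pays for when z is very negative (`subExp_source_ge`). Monotonicity of b is replaced by a quadratic
minorant valid at all larger arguments up to k (`exists_monotone_lower`). -/

theorem antitone_of_hasDerivAt_nonpos_off_point {f f' : ℝ → ℝ} (z : ℝ) (hf : Continuous f)
    (hd : ∀ x, x ≠ z → HasDerivAt f (f' x) x) (hn : ∀ x, x ≠ z → f' x ≤ 0) : Antitone f := by
  refine AntitoneOn.Iic_union_Ici (a := z) ?_ ?_
  · refine antitoneOn_of_deriv_nonpos (convex_Iic z) hf.continuousOn ?_ ?_ <;>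
      rw [interior_Iic]
    · exact fun x hx => (hd x (ne_of_lt hx)).differentiableAt.differentiableWithinAt
    · intro x hx
      rw [(hd x (ne_of_lt hx)).deriv]
      exact hn x (ne_of_lt hx)
  · refine antitoneOn_of_deriv_nonpos (convex_Ici z) hf.continuousOn ?_ ?_ <;>
      rw [interior_Ici]
    · exact fun x hx => (hd x (ne_of_gt hx)).differentiableAt.differentiableWithinAt
    · intro x hx
      rw [(hd x (ne_of_gt hx)).deriv]
      exact hn x (ne_of_gt hx)

theorem monotone_of_hasDerivAt_nonneg {f f' : ℝ → ℝ}
    (hd : ∀ x, HasDerivAt f (f' x) x) (hn : ∀ x, 0 ≤ f' x) : Monotone f :=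
  monotone_of_deriv_nonneg (fun x => (hd x).differentiableAt) fun x => by
    rw [(hd x).deriv]; exact hn x

theorem hasDerivAt_exp_mul {k x : ℝ} :
    HasDerivAt (fun x => Real.exp (k * x)) (k * Real.exp (k * x)) x := by
  have := ((hasDerivAt_id x).const_mul k).exp
  simpa [mul_comm] using this

theorem hasDerivAt_exp_mul_mul {f : ℝ → ℝ} {f' k x : ℝ} (hf : HasDerivAt f f' x) :
    HasDerivAt (fun x => Real.exp (k * x) * f x) (Real.exp (k * x) * (k * f x + f')) x := by
  exact (hasDerivAt_exp_mul.fun_mul hf).congr_deriv (by ring)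

/-- Maximum principle for `(D + α)(D - β)`, in the factorized form `w' = β w + v`,
`v' ≤ -α v`. -/
theorem nonneg_of_factorized_le {α β z : ℝ} {w v v' : ℝ → ℝ} (hv : Continuous v)
    (hw : Continuous w) (hw' : ∀ x, x ≠ z → HasDerivAt w (β * w x + v x) x)
    (hv' : ∀ x, x ≠ z → HasDerivAt v (v' x) x) (hle : ∀ x, x ≠ z → v' x ≤ -α * v x)
    (hbot : Tendsto (fun x => Real.exp (α * x) * v x) atBot (𝓝 0))
    (htop : Tendsto (fun x => Real.exp (-β * x) * w x) atTop (𝓝 0)) (x : ℝ) : 0 ≤ w x := by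
  -- The integrating factor and the limit at -∞ give v ≤ 0; then the second factor and the limit at
  -- +∞ give w ≥ 0. The point z is exempt because the second derivative of the lower barrier jumps
  -- there.
  have h1 : Antitone fun x => Real.exp (α * x) * v x := by
    refine antitone_of_hasDerivAt_nonpos_off_point z (by fun_prop)
      (fun x hx => hasDerivAt_exp_mul_mul (hv' x hx)) fun x hx => ?_
    exact mul_nonpos_of_nonneg_of_nonpos (Real.exp_nonneg _) (by linarith [hle x hx])
  have h2 : ∀ x, v x ≤ 0 := fun x => by
    have := h1.ge_of_tendsto hbot x
    by_contra! h
    exact absurd this (not_le.2 (mul_pos (Real.exp_pos _) h))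
  have h3 : Antitone fun x => Real.exp (-β * x) * w x := by
    refine antitone_of_hasDerivAt_nonpos_off_point z (by fun_prop)
      (fun x hx => hasDerivAt_exp_mul_mul (hw' x hx)) fun x _ => ?_
    exact mul_nonpos_of_nonneg_of_nonpos (Real.exp_nonneg _) (by linarith [h2 x])
  have := h3.le_of_tendsto htop x
  by_contra! h
  exact absurd this (not_le.2 (mul_neg_of_pos_of_neg (Real.exp_pos _) h))

/-- A common Lipschitz constant gives equicontinuity and, with the bound at 0, the pointwise bound R
+ C|x|; Arzelà–Ascoli applies in the compact-open topology. -/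
theorem exists_subseq_tendsto_of_lipschitz {C : NNReal} {R : ℝ} (u : ℕ → ℝ → ℝ)
    (hL : ∀ n, LipschitzWith C (u n)) (hb : ∀ n, |u n 0| ≤ R) :
    ∃ (φ : ℝ → ℝ) (σ : ℕ → ℕ), StrictMono σ ∧ LipschitzWith C φ ∧
      ∀ x, Tendsto (fun n => u (σ n) x) atTop (𝓝 (φ x)) := by
  let S : Set C(ℝ, ℝ) := {f | LipschitzWith C f ∧ |f 0| ≤ R}
  have himg : ContinuousMap.toFun '' S = {f : ℝ → ℝ | LipschitzWith C f ∧ |f 0| ≤ R} := by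
    ext f
    constructor
    · rintro ⟨g, hg, rfl⟩
      exact hg
    · intro hf
      exact ⟨⟨f, hf.1.continuous⟩, hf, rfl⟩
  have hS : IsCompact S := by
    refine ArzelaAscoli.isCompact_of_equicontinuous S ?_ ?_
    · rw [himg]
      refine (isCompact_univ_pi fun x : ℝ =>
        isCompact_Icc (a := -(R + C * |x|)) (b := R + C * |x|)).of_isClosed_subset ?_ ?_
      · simp only [lipschitzWith_iff_dist_le_mul, ofPred_and, ofPred_forall]
        refine IsClosed.inter ?_ ?_
        · exact isClosed_iInter fun x => isClosed_iInter fun y =>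
            isClosed_le (by fun_prop) (by fun_prop)
        · exact isClosed_le (by fun_prop) (by fun_prop)
      · intro f hf x _
        have h1 := hf.1.dist_le_mul x 0
        rw [Real.dist_eq, Real.dist_eq, sub_zero] at h1
        have h2 := hf.2
        rw [abs_le] at h1 h2
        exact ⟨by linarith, by linarith⟩
    · exact (LipschitzWith.uniformEquicontinuous (fun f : S => ((f : C(ℝ, ℝ)) : ℝ → ℝ)) C
        fun f => f.2.1).equicontinuous
  obtain ⟨φ, hφ, σ, hσ, hlim⟩ := hS.tendsto_subseq
    (x := fun n => (⟨u n, (hL n).continuous⟩ : C(ℝ, ℝ))) fun n => ⟨hL n, hb n⟩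
  refine ⟨φ, σ, hσ, hφ.1, fun x => ?_⟩
  exact ((continuous_eval_const (F := C(ℝ, ℝ)) x).tendsto φ).comp hlim

theorem tendsto_apply_of_lipschitz {C : NNReal} {u : ℕ → ℝ → ℝ} {φ : ℝ → ℝ}
    (hL : ∀ n, LipschitzWith C (u n)) (hu : ∀ x, Tendsto (fun n => u n x) atTop (𝓝 (φ x)))
    {y : ℕ → ℝ} {x : ℝ} (hy : Tendsto y atTop (𝓝 x)) :
    Tendsto (fun n => u n (y n)) atTop (𝓝 (φ x)) := by
  have h0 : Tendsto (fun n => u n (y n) - u n x) atTop (𝓝 0) := by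
    refine squeeze_zero_norm (a := fun n => C * dist (y n) x) (fun n => ?_) ?_
    · rw [← dist_eq_norm]
      exact (hL n).dist_le_mul _ _
    · simpa using (tendsto_iff_dist_tendsto_zero.1 hy).const_mul (C : ℝ)
  simpa using h0.add (hu x)

theorem hasDerivAt_of_eq_add_integral {f g : ℝ → ℝ} (hg : Continuous g)
    (h : ∀ x, f x = f 0 + ∫ s in (0 : ℝ)..x, g s) (x : ℝ) : HasDerivAt f (g x) x := by
  have h1 := intervalIntegral.integral_hasDerivAt_right (hg.intervalIntegrable 0 x)
    (hg.stronglyMeasurableAtFilter _ _) hg.continuousAt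
  rw [show f = fun x => f 0 + ∫ s in (0 : ℝ)..x, g s from funext h]
  simpa using h1.const_add (f 0)

/-! ### The delayed problem on a bounded interval -/

/-- The state-dependent source `G(x, φ(x))`, `x = s - T(s, φ(s))`, with an additional delay `ε`
and with all arguments truncated from below at `-R`. -/
noncomputable def delayedSource (T G : ℝ → ℝ → ℝ) (R ε : ℝ) (φ : ℝ → ℝ) (s : ℝ) : ℝ :=
  G (max (max (s - ε) (-R) - T (max (s - ε) (-R)) (φ (max (s - ε) (-R)))) (-R))
    (φ (max (max (s - ε) (-R) - T (max (s - ε) (-R)) (φ (max (s - ε) (-R)))) (-R)))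

/-- The solution of `v' = -α v - h`, `v(-R) = 0`. -/
noncomputable def stableSol (α R : ℝ) (h : ℝ → ℝ) (x : ℝ) : ℝ :=
  Real.exp (-α * x) * -(∫ s in (-R)..x, Real.exp (α * s) * h s)

/-- The solution of `w' = β w + v`, `w(-R) = e^{-β R} a`. -/
noncomputable def unstableSol (β R a : ℝ) (v : ℝ → ℝ) (x : ℝ) : ℝ :=
  Real.exp (β * x) * (a + ∫ s in (-R)..x, Real.exp (-β * s) * v s)

/-- The iterates of the method of steps. -/
noncomputable def stepIter (T G : ℝ → ℝ → ℝ) (α β R ε : ℝ) : ℕ → ℝ → ℝ → ℝ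
  | 0, _, _ => 0
  | k + 1, a, x => unstableSol β R a
      (stableSol α R (delayedSource T G R ε (stepIter T G α β R ε k a))) x

theorem hasDerivAt_stableSol (α R : ℝ) {h : ℝ → ℝ} (hh : Continuous h) (x : ℝ) :
    HasDerivAt (stableSol α R h) (-α * stableSol α R h x - h x) x := by
  have hc : Continuous fun s => Real.exp (α * s) * h s := by fun_prop
  have h1 := intervalIntegral.integral_hasDerivAt_right (hc.intervalIntegrable (-R) x)
    (hc.stronglyMeasurableAtFilter _ _) hc.continuousAt
  refine (hasDerivAt_exp_mul_mul (k := -α) h1.fun_neg).congr_deriv ?_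
  have : Real.exp (-α * x) * Real.exp (α * x) = 1 := by
    rw [← Real.exp_add]; simp
  unfold stableSol
  linear_combination -h x * this

theorem hasDerivAt_unstableSol (β R a : ℝ) {v : ℝ → ℝ} (hv : Continuous v) (x : ℝ) :
    HasDerivAt (unstableSol β R a v) (β * unstableSol β R a v x + v x) x := by
  have hc : Continuous fun s => Real.exp (-β * s) * v s := by fun_prop
  have h1 := intervalIntegral.integral_hasDerivAt_right (hc.intervalIntegrable (-R) x)
    (hc.stronglyMeasurableAtFilter _ _) hc.continuousAt
  refine (hasDerivAt_exp_mul_mul (k := β) (h1.const_add a)).congr_deriv ?_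
  have : Real.exp (β * x) * Real.exp (-β * x) = 1 := by
    rw [← Real.exp_add]; simp
  unfold unstableSol
  linear_combination v x * this

theorem abs_stableSol_le {α R B : ℝ} (hα : 0 < α) {h : ℝ → ℝ} (hh : Continuous h)
    (hB : ∀ x, |h x| ≤ B) {x : ℝ} (hx : -R ≤ x) : |stableSol α R h x| ≤ B / α := by
  have hd := hasDerivAt_stableSol α R hh
  have h0 : stableSol α R h (-R) = 0 := by simp [stableSol]
  have hB0 : 0 ≤ B := (abs_nonneg _).trans (hB 0)
  have hBα : α * (B / α) = B := by field_simp
  have hq : 0 ≤ B / α := by positivity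
  have e1 : Monotone fun x => Real.exp (α * x) * (stableSol α R h x + B / α) :=
    monotone_of_hasDerivAt_nonneg (fun x => hasDerivAt_exp_mul_mul ((hd x).add_const _))
      fun x => mul_nonneg (Real.exp_nonneg _) (by linarith [abs_le.1 (hB x)])
  have e2 : Monotone fun x => Real.exp (α * x) * (B / α - stableSol α R h x) :=
    monotone_of_hasDerivAt_nonneg (fun x => hasDerivAt_exp_mul_mul ((hd x).const_sub _))
      fun x => mul_nonneg (Real.exp_nonneg _) (by linarith [abs_le.1 (hB x)])
  have f1 := e1 hx
  have f2 := e2 hx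
  simp only [h0, zero_add, sub_zero] at f1 f2
  have hp : 0 ≤ Real.exp (α * -R) * (B / α) := by positivity
  have g1 := nonneg_of_mul_nonneg_right (hp.trans f1) (Real.exp_pos _)
  have g2 := nonneg_of_mul_nonneg_right (hp.trans f2) (Real.exp_pos _)
  exact abs_le.2 ⟨by linarith, by linarith⟩

/-- A solution of `w' = β w + v` that vanishes at `R` is bounded by `sup |v| / β` before. -/
theorem abs_le_of_unstable {β R C : ℝ} (hβ : 0 < β) {w v : ℝ → ℝ}
    (hw : ∀ x, HasDerivAt w (β * w x + v x) x) (hv : ∀ x ∈ Icc (-R) R, |v x| ≤ C)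
    (h0 : w R = 0) {x : ℝ} (hx : x ∈ Icc (-R) R) : |w x| ≤ C / β := by
  have hC0 : 0 ≤ C := (abs_nonneg _).trans (hv x hx)
  have hCβ : β * (C / β) = C := by field_simp
  have hcw : Continuous w := continuous_iff_continuousAt.2 fun x => (hw x).continuousAt
  have e1 : MonotoneOn (fun x => Real.exp (-β * x) * (w x - C / β)) (Icc (-R) R) := by
    refine monotoneOn_of_deriv_nonneg (convex_Icc _ _) (by fun_prop) ?_ ?_
    · exact fun x _ => (hasDerivAt_exp_mul_mul
        ((hw x).sub_const (C / β))).differentiableAt.differentiableWithinAt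
    · intro y hy
      rw [(hasDerivAt_exp_mul_mul ((hw y).sub_const (C / β))).deriv]
      exact mul_nonneg (Real.exp_nonneg _)
        (by linarith [abs_le.1 (hv y (interior_subset hy))])
  have e2 : MonotoneOn (fun x => Real.exp (-β * x) * (-C / β - w x)) (Icc (-R) R) := by
    refine monotoneOn_of_deriv_nonneg (convex_Icc _ _) (by fun_prop) ?_ ?_
    · exact fun x _ => (hasDerivAt_exp_mul_mul
        ((hw x).const_sub (-C / β))).differentiableAt.differentiableWithinAt
    · intro y hy
      rw [(hasDerivAt_exp_mul_mul ((hw y).const_sub (-C / β))).deriv, neg_div]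
      exact mul_nonneg (Real.exp_nonneg _)
        (by linarith [abs_le.1 (hv y (interior_subset hy))])
  have hR : R ∈ Icc (-R) R := ⟨hx.1.trans hx.2, le_rfl⟩
  have f1 := e1 hx hR hx.2
  have f2 := e2 hx hR hx.2
  simp only [h0, zero_sub, sub_zero] at f1 f2
  have hp : 0 ≤ Real.exp (-β * R) * (C / β) := by positivity
  have g1 : w x - C / β ≤ 0 := by
    by_contra! hh
    linarith [mul_pos (Real.exp_pos (-β * x)) hh]
  have g2 : -C / β - w x ≤ 0 := by
    by_contra! hh
    have := mul_pos (Real.exp_pos (-β * x)) hh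
    rw [neg_div, mul_neg] at f2
    rw [neg_div] at this
    linarith
  rw [neg_div] at g2
  exact abs_le.2 ⟨by linarith, by linarith⟩

variable {T G : ℝ → ℝ → ℝ}

theorem continuous_delayedSource {X : Type*} [TopologicalSpace X]
    (hT : Continuous fun q : ℝ × ℝ => T q.1 q.2) (hG : Continuous fun q : ℝ × ℝ => G q.1 q.2)
    (R ε : ℝ) {g : X → ℝ → ℝ} (hg : Continuous fun q : X × ℝ => g q.1 q.2) :
    Continuous fun q : X × ℝ => delayedSource T G R ε (g q.1) q.2 := by
  have h1 : Continuous fun q : X × ℝ => max (q.2 - ε) (-R) := by fun_prop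
  have h2 : Continuous fun q : X × ℝ => g q.1 (max (q.2 - ε) (-R)) :=
    hg.comp (continuous_fst.prodMk h1)
  have h3 : Continuous fun q : X × ℝ =>
      max (max (q.2 - ε) (-R) - T (max (q.2 - ε) (-R)) (g q.1 (max (q.2 - ε) (-R)))) (-R) :=
    (h1.sub (hT.comp (h1.prodMk h2))).max continuous_const
  exact hG.comp (h3.prodMk (hg.comp (continuous_fst.prodMk h3)))

theorem continuous_stableSol {X : Type*} [TopologicalSpace X] (α R : ℝ) {g : X → ℝ → ℝ}
    (hg : Continuous fun q : X × ℝ => g q.1 q.2) :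
    Continuous fun q : X × ℝ => stableSol α R (g q.1) q.2 := by
  have h1 : Continuous fun q : X × ℝ => ∫ s in (-R)..q.2, Real.exp (α * s) * g q.1 s := by
    refine intervalIntegral.continuous_parametric_intervalIntegral_of_continuous ?_
      continuous_snd
    exact (by fun_prop : Continuous fun q : (X × ℝ) × ℝ => Real.exp (α * q.2)).mul
      (hg.comp ((continuous_fst.comp continuous_fst).prodMk continuous_snd))
  unfold stableSol
  fun_prop

theorem continuous_unstableSol (β R : ℝ) {g : ℝ → ℝ → ℝ}
    (hg : Continuous fun q : ℝ × ℝ => g q.1 q.2) :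
    Continuous fun q : ℝ × ℝ => unstableSol β R q.1 (g q.1) q.2 := by
  have h1 : Continuous fun q : ℝ × ℝ => ∫ s in (-R)..q.2, Real.exp (-β * s) * g q.1 s := by
    refine intervalIntegral.continuous_parametric_intervalIntegral_of_continuous ?_
      continuous_snd
    exact (by fun_prop : Continuous fun q : (ℝ × ℝ) × ℝ => Real.exp (-β * q.2)).mul
      (hg.comp ((continuous_fst.comp continuous_fst).prodMk continuous_snd))
  unfold unstableSol
  fun_prop

/-- Continuity jointly with the shooting parameter `a` is what the intermediate value argument at
the right endpoint needs. -/
theorem continuous_stepIter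
    (hT : Continuous fun q : ℝ × ℝ => T q.1 q.2) (hG : Continuous fun q : ℝ × ℝ => G q.1 q.2)
    (α β R ε : ℝ) (k : ℕ) :
    Continuous fun q : ℝ × ℝ => stepIter T G α β R ε k q.1 q.2 := by
  induction k with
  | zero => exact continuous_const
  | succ k ih =>
    exact continuous_unstableSol β R
      (g := fun a => stableSol α R (delayedSource T G R ε (stepIter T G α β R ε k a)))
      (continuous_stableSol α R
        (g := fun a => delayedSource T G R ε (stepIter T G α β R ε k a))
        (continuous_delayedSource hT hG R ε ih))

theorem delayedSource_congr (hT0 : ∀ x u, 0 ≤ T x u) {R ε y : ℝ} {f g : ℝ → ℝ}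
    (h : ∀ x ∈ Icc (-R) y, f x = g x) {s : ℝ} (hy : -R ≤ y) (hs : s - ε ≤ y) :
    delayedSource T G R ε f s = delayedSource T G R ε g s := by
  have h1 : max (s - ε) (-R) ∈ Icc (-R) y := ⟨le_max_right _ _, max_le hs hy⟩
  have h2 : max (max (s - ε) (-R) - T (max (s - ε) (-R)) (g (max (s - ε) (-R)))) (-R)
      ∈ Icc (-R) y :=
    ⟨le_max_right _ _, max_le ((sub_le_self _ (hT0 _ _)).trans h1.2) hy⟩
  unfold delayedSource
  rw [h _ h1, h _ h2]

/-- The source at s sees only values at arguments up to s - ε, so each further iteration extends the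
interval of agreement by ε. Indices start at 1 because the zeroth iterate has the wrong value at -R.
-/
theorem stepIter_stable (hT0 : ∀ x u, 0 ≤ T x u) {α β R ε : ℝ} (hε : 0 ≤ ε) (a : ℝ) (k : ℕ) :
    ∀ x ∈ Icc (-R) (-R + k * ε),
      stepIter T G α β R ε (k + 2) a x = stepIter T G α β R ε (k + 1) a x := by
  induction k with
  | zero =>
    intro x hx
    have : x = -R := le_antisymm (by simpa using hx.2) hx.1
    subst this
    simp [stepIter, unstableSol]
  | succ k ih =>
    intro x hx
    have key : ∀ s ∈ Icc (-R) x, delayedSource T G R ε (stepIter T G α β R ε (k + 2) a) s =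
        delayedSource T G R ε (stepIter T G α β R ε (k + 1) a) s := by
      intro s hs
      refine delayedSource_congr hT0 ih ?_ ?_
      · have : (0 : ℝ) ≤ k * ε := by positivity
        linarith
      · have := hx.2
        push_cast at this
        linarith [hs.2]
    have key2 : ∀ s ∈ Icc (-R) x,
        stableSol α R (delayedSource T G R ε (stepIter T G α β R ε (k + 2) a)) s =
        stableSol α R (delayedSource T G R ε (stepIter T G α β R ε (k + 1) a)) s := by
      intro s hs
      unfold stableSol
      congr 2
      refine intervalIntegral.integral_congr fun r hr => ?_
      rw [uIcc_of_le hs.1] at hr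
      simp only [key r ⟨hr.1, hr.2.trans hs.2⟩]
    show unstableSol β R a _ x = unstableSol β R a _ x
    unfold unstableSol
    congr 2
    refine intervalIntegral.integral_congr fun r hr => ?_
    rw [uIcc_of_le hx.1] at hr
    simp only [key2 r hr]

/-- After about 2R/ε iterations the iterate reproduces itself on [-R, R]. The free parameter `a` is
then chosen so that φ(R) = 0, which bounds the mode e^{βx} independently of R and ε. -/
theorem exists_solution_on_interval (hT : Continuous fun q : ℝ × ℝ => T q.1 q.2)
    (hG : Continuous fun q : ℝ × ℝ => G q.1 q.2) (hT0 : ∀ x u, 0 ≤ T x u) {B : ℝ}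
    (hB : ∀ x u, |G x u| ≤ B) {α β R ε : ℝ} (hα : 0 < α) (hβ : 0 < β) (hR : 0 < R)
    (hε : 0 < ε) :
    ∃ φ v h : ℝ → ℝ, Continuous h ∧ (∀ x, |h x| ≤ B) ∧
      (∀ x, HasDerivAt φ (β * φ x + v x) x) ∧ (∀ x, HasDerivAt v (-α * v x - h x) x) ∧
      (∀ x ∈ Icc (-R) R, h x = delayedSource T G R ε φ x) ∧
      (∀ x ∈ Icc (-R) R, |φ x| ≤ B / α / β) ∧ (∀ x ∈ Icc (-R) R, |v x| ≤ B / α) := by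
  obtain ⟨k, hk⟩ := exists_nat_ge (2 * R / ε)
  have hk' : R ≤ -R + k * ε := by
    rw [div_le_iff₀ hε] at hk
    linarith
  let h : ℝ → ℝ → ℝ := fun a => delayedSource T G R ε (stepIter T G α β R ε (k + 1) a)
  have hh : Continuous fun q : ℝ × ℝ => h q.1 q.2 :=
    continuous_delayedSource hT hG R ε (continuous_stepIter hT hG α β R ε (k + 1))
  have hh1 : ∀ a, Continuous (h a) := fun a => hh.comp (Continuous.prodMk_right a)
  have hhB : ∀ a x, |h a x| ≤ B := fun a x => hB _ _
  have hv1 : ∀ a x, -R ≤ x → |stableSol α R (h a) x| ≤ B / α := fun a x hx =>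
    abs_stableSol_le hα (hh1 a) (hhB a) hx
  have hvc : ∀ a, Continuous (stableSol α R (h a)) := fun a =>
    continuous_iff_continuousAt.2 fun x => (hasDerivAt_stableSol α R (hh1 a) x).continuousAt
  have hint : ∀ a, |∫ s in (-R)..R, Real.exp (-β * s) * stableSol α R (h a) s| ≤
      Real.exp (β * R) * (B / α) * |R - -R| := by
    intro a
    rw [← Real.norm_eq_abs]
    refine intervalIntegral.norm_integral_le_of_norm_le_const fun s hs => ?_
    rw [uIoc_of_le (by linarith)] at hs
    rw [norm_mul, Real.norm_eq_abs, Real.norm_eq_abs, Real.abs_exp]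
    refine mul_le_mul (Real.exp_le_exp.2 ?_) (hv1 a s hs.1.le) (abs_nonneg _)
      (Real.exp_nonneg _)
    nlinarith [hs.1]
  -- D bounds the integral in φ(R) uniformly in `a`, so `a = -D` and `a = D` give endpoint values of
  -- opposite (weak) signs.
  set D := Real.exp (β * R) * (B / α) * |R - -R|
  have hcont : Continuous fun a => stepIter T G α β R ε (k + 2) a R :=
    (continuous_stepIter hT hG α β R ε (k + 2)).comp (Continuous.prodMk_left R)
  obtain ⟨a, ha⟩ := mem_range_of_exists_le_of_exists_ge (c := 0) hcont
    ⟨-D, mul_nonpos_of_nonneg_of_nonpos (Real.exp_nonneg _)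
      (by linarith [(abs_le.1 (hint (-D))).2])⟩
    ⟨D, mul_nonneg (Real.exp_nonneg _) (by linarith [(abs_le.1 (hint D)).1])⟩
  have hd : ∀ x, HasDerivAt (stepIter T G α β R ε (k + 2) a)
      (β * stepIter T G α β R ε (k + 2) a x + stableSol α R (h a) x) x :=
    hasDerivAt_unstableSol β R a (hvc a)
  refine ⟨stepIter T G α β R ε (k + 2) a, stableSol α R (h a), h a, hh1 a, hhB a, hd,
    hasDerivAt_stableSol α R (hh1 a), fun x hx => ?_, fun x hx => ?_,
    fun x hx => hv1 a x hx.1⟩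
  · refine delayedSource_congr hT0 (fun y hy => (stepIter_stable hT0 hε.le a k y hy).symm) ?_ ?_
    · linarith
    · linarith [hx.2]
  · exact abs_le_of_unstable hβ hd (fun x hx => hv1 a x hx.1) ha hx

/-! ### Bounded solutions on the whole line -/

/-- The integrated form of the equation passes to the limit by dominated convergence, so no uniform
convergence of derivatives is needed. -/
theorem hasDerivAt_of_tendsto {f g : ℕ → ℝ → ℝ} {F H : ℝ → ℝ} {C : ℝ}
    (hf : ∀ n x, HasDerivAt (f n) (g n x) x) (hg : ∀ n, Continuous (g n)) (hH : Continuous H)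
    (hlimf : ∀ x, Tendsto (fun n => f n x) atTop (𝓝 (F x)))
    (hlimg : ∀ x, Tendsto (fun n => g n x) atTop (𝓝 (H x)))
    (hb : ∀ r : ℝ, ∀ᶠ n in atTop, ∀ s, |s| ≤ r → |g n s| ≤ C) (x : ℝ) :
    HasDerivAt F (H x) x := by
  refine hasDerivAt_of_eq_add_integral hH (fun y => ?_) x
  have h1 : ∀ n, f n y = f n 0 + ∫ s in (0 : ℝ)..y, g n s := fun n => by
    rw [intervalIntegral.integral_eq_sub_of_hasDerivAt (fun s _ => hf n s)
      ((hg n).intervalIntegrable _ _)]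
    ring
  have h2 : Tendsto (fun n => ∫ s in (0 : ℝ)..y, g n s) atTop
      (𝓝 (∫ s in (0 : ℝ)..y, H s)) := by
    refine intervalIntegral.tendsto_integral_filter_of_dominated_convergence (fun _ => C)
      (Eventually.of_forall fun n => (hg n).aestronglyMeasurable) ?_ (by simp)
      (Eventually.of_forall fun s _ => hlimg s)
    filter_upwards [hb |y|] with n hn
    refine Eventually.of_forall fun s hs => hn s ?_
    have := abs_sub_left_of_mem_uIcc (uIoc_subset_uIcc hs)
    simpa using this
  have h3 := hlimf y
  rw [show (fun n => f n y) = _ from funext h1] at h3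
  exact tendsto_nhds_unique h3 ((hlimf 0).add h2)

theorem tendsto_delayedSource (hT : Continuous fun q : ℝ × ℝ => T q.1 q.2)
    (hG : Continuous fun q : ℝ × ℝ => G q.1 q.2) {C : NNReal} {R ε : ℕ → ℝ} {u : ℕ → ℝ → ℝ}
    {φ : ℝ → ℝ} (hR : Tendsto R atTop atTop) (hε : Tendsto ε atTop (𝓝 0))
    (hL : ∀ n, LipschitzWith C (u n)) (hu : ∀ x, Tendsto (fun n => u n x) atTop (𝓝 (φ x)))
    (x : ℝ) :
    Tendsto (fun n => delayedSource T G (R n) (ε n) (u n) x) atTop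
      (𝓝 (G (x - T x (φ x)) (φ (x - T x (φ x))))) := by
  have hmax : ∀ {y : ℕ → ℝ} {l : ℝ}, Tendsto y atTop (𝓝 l) →
      Tendsto (fun n => max (y n) (-R n)) atTop (𝓝 l) := by
    intro y l hy
    refine hy.congr' ?_
    filter_upwards [hy.eventually (lt_mem_nhds (sub_one_lt l)),
      hR.eventually_ge_atTop (-(l - 1))] with n h1 h2
    exact (max_eq_left (by linarith)).symm
  have h1 : Tendsto (fun n => max (x - ε n) (-R n)) atTop (𝓝 x) :=
    hmax (by simpa using hε.const_sub x)
  have h2 := tendsto_apply_of_lipschitz hL hu h1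
  have h3 := hmax (h1.sub ((hT.tendsto (x, φ x)).comp (h1.prodMk_nhds h2)))
  exact (hG.tendsto (_, _)).comp (h3.prodMk_nhds (tendsto_apply_of_lipschitz hL hu h3))

theorem exists_bounded_solution (hT : Continuous fun q : ℝ × ℝ => T q.1 q.2)
    (hG : Continuous fun q : ℝ × ℝ => G q.1 q.2) (hT0 : ∀ x u, 0 ≤ T x u) {B : ℝ}
    (hB : ∀ x u, |G x u| ≤ B) {α β : ℝ} (hα : 0 < α) (hβ : 0 < β) :
    ∃ φ v : ℝ → ℝ, (∀ x, HasDerivAt φ (β * φ x + v x) x) ∧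
      (∀ x, HasDerivAt v (-α * v x - G (x - T x (φ x)) (φ (x - T x (φ x)))) x) ∧
      (∀ x, |φ x| ≤ B / α / β) ∧ (∀ x, |v x| ≤ B / α) := by
  have hB0 : 0 ≤ B := (abs_nonneg _).trans (hB 0 0)
  have hR : ∀ n : ℕ, (0 : ℝ) < n + 1 := fun n => by positivity
  choose φ v h hhc hhB hφ hv hh hφb hvb using fun n : ℕ =>
    exists_solution_on_interval hT hG hT0 hB (ε := 1 / ((n : ℝ) + 1)) hα hβ (hR n)
      (by positivity)
  obtain ⟨C, hC⟩ : ∃ C : NNReal, (C : ℝ) = β * (B / α / β) + B / α + (α * (B / α) + B) :=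
    ⟨⟨_, by positivity⟩, rfl⟩
  have q1 : 0 ≤ α * (B / α) := by positivity
  have q2 : 0 ≤ B / α := by positivity
  have q3 : 0 ≤ β * (B / α / β) := by positivity
  have hφ'b : ∀ n : ℕ, ∀ x ∈ Icc (-((n : ℝ) + 1)) (n + 1), |β * φ n x + v n x| ≤ C := by
    intro n x hx
    refine (abs_add_le _ _).trans ?_
    rw [abs_mul, abs_of_pos hβ, hC]
    have := mul_le_mul_of_nonneg_left (hφb n x hx) hβ.le
    linarith [hvb n x hx]
  have hv'b : ∀ n : ℕ, ∀ x ∈ Icc (-((n : ℝ) + 1)) (n + 1), |-α * v n x - h n x| ≤ C := by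
    intro n x hx
    refine (abs_sub _ _).trans ?_
    rw [abs_mul, abs_neg, abs_of_pos hα, hC]
    have := mul_le_mul_of_nonneg_left (hvb n x hx) hα.le
    linarith [hhB n x]
  have hlip : ∀ {f f' : ℝ → ℝ} {s : Set ℝ}, Convex ℝ s → (∀ x, HasDerivAt f (f' x) x) →
      (∀ x ∈ s, |f' x| ≤ C) → LipschitzOnWith C f s := fun hs hf hf' =>
    hs.lipschitzOnWith_of_nnnorm_hasDerivWithin_le (fun x _ => (hf x).hasDerivWithinAt)
      fun x hx => by
        rw [← NNReal.coe_le_coe, coe_nnnorm]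
        exact hf' x hx
  -- The derivative bounds hold only on the n-th interval; Lipschitz extension from it makes
  -- compactness on the whole line available.
  choose u huL hu using fun n : ℕ =>
    (hlip (convex_Icc (-((n : ℝ) + 1)) (n + 1)) (hφ n) (hφ'b n)).extend_real
  choose w hwL hw using fun n : ℕ =>
    (hlip (convex_Icc (-((n : ℝ) + 1)) (n + 1)) (hv n) (hv'b n)).extend_real
  have h0 : ∀ n : ℕ, (0 : ℝ) ∈ Icc (-((n : ℝ) + 1)) (n + 1) := fun n =>
    ⟨by linarith [hR n], (hR n).le⟩
  obtain ⟨Φ, σ, hσ, hΦL, hΦ⟩ := exists_subseq_tendsto_of_lipschitz (R := B / α / β) u huL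
    fun n => by rw [← hu n (h0 n)]; exact hφb n 0 (h0 n)
  obtain ⟨V, ρ, hρ, hVL, hV⟩ := exists_subseq_tendsto_of_lipschitz (R := B / α)
    (fun n => w (σ n)) (fun n => hwL _)
    fun n => by rw [← hw _ (h0 _)]; exact hvb _ 0 (h0 _)
  let k : ℕ → ℕ := fun n => σ (ρ n)
  have hk : Tendsto k atTop atTop := hσ.tendsto_atTop.comp hρ.tendsto_atTop
  have hkR : Tendsto (fun n => (k n : ℝ) + 1) atTop atTop :=
    tendsto_atTop_add_const_right _ _ (tendsto_natCast_atTop_atTop.comp hk)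
  have hmem : ∀ r : ℝ, ∀ᶠ n in atTop, ∀ s, |s| ≤ r →
      s ∈ Icc (-((k n : ℝ) + 1)) ((k n : ℝ) + 1) := fun r => by
    filter_upwards [hkR.eventually_ge_atTop r] with n hn s hs
    exact abs_le.1 (hs.trans hn)
  have hΦ' : ∀ x, Tendsto (fun n => u (k n) x) atTop (𝓝 (Φ x)) := fun x =>
    (hΦ x).comp hρ.tendsto_atTop
  have lφ : ∀ x, Tendsto (fun n => φ (k n) x) atTop (𝓝 (Φ x)) := fun x => by
    refine (hΦ' x).congr' ?_
    filter_upwards [hmem |x|] with n hn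
    exact (hu _ (hn x le_rfl)).symm
  have lv : ∀ x, Tendsto (fun n => v (k n) x) atTop (𝓝 (V x)) := fun x => by
    refine (hV x).congr' ?_
    filter_upwards [hmem |x|] with n hn
    exact (hw _ (hn x le_rfl)).symm
  have lh : ∀ x, Tendsto (fun n => h (k n) x) atTop
      (𝓝 (G (x - T x (Φ x)) (Φ (x - T x (Φ x))))) := fun x => by
    refine (tendsto_delayedSource hT hG hkR
      (tendsto_one_div_add_atTop_nhds_zero_nat.comp hk) (fun n => huL (k n)) hΦ' x).congr' ?_
    filter_upwards [hmem |x|] with n hn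
    have hx := hn x le_rfl
    rw [hh _ x hx]
    refine (delayedSource_congr hT0 (y := (k n : ℝ) + 1) (fun y hy => hu _ hy) ?_ ?_).symm
    · linarith [hR (k n)]
    · have : 0 < 1 / ((k n : ℝ) + 1) := by positivity
      show x - 1 / ((k n : ℝ) + 1) ≤ _
      linarith [hx.2]
  have hΦc := hΦL.continuous
  have hVc := hVL.continuous
  have hcont : ∀ {f f' : ℝ → ℝ}, (∀ x, HasDerivAt f (f' x) x) → Continuous f := fun hf =>
    continuous_iff_continuousAt.2 fun x => (hf x).continuousAt
  have hTc : Continuous fun x => x - T x (Φ x) :=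
    continuous_id.sub (hT.comp (continuous_id.prodMk hΦc))
  refine ⟨Φ, V, ?_, ?_, fun x => ?_, fun x => ?_⟩
  · refine hasDerivAt_of_tendsto (C := C) (fun n => hφ (k n)) (fun n => ?_) (by fun_prop) lφ
      (fun x => ((lφ x).const_mul β).add (lv x)) fun r => ?_
    · have := hcont (hφ (k n))
      have := hcont (hv (k n))
      fun_prop
    · filter_upwards [hmem r] with n hn s hs using hφ'b _ s (hn s hs)
  · refine hasDerivAt_of_tendsto (C := C) (fun n => hv (k n)) (fun n => ?_) ?_ lv
      (fun x => ((lv x).const_mul (-α)).sub (lh x)) fun r => ?_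
    · have := hcont (hv (k n))
      have := hhc (k n)
      fun_prop
    · exact (hVc.const_mul _).sub (hG.comp (hTc.prodMk (hΦc.comp hTc)))
    · filter_upwards [hmem r] with n hn s hs using hv'b _ s (hn s hs)
  · refine le_of_tendsto (lφ x).abs ?_
    filter_upwards [hmem |x|] with n hn using hφb _ x (hn x le_rfl)
  · refine le_of_tendsto (lv x).abs ?_
    filter_upwards [hmem |x|] with n hn using hvb _ x (hn x le_rfl)

/-! ### Barriers -/

theorem tendsto_exp_mul_atBot {k : ℝ} (hk : 0 < k) :
    Tendsto (fun x => Real.exp (k * x)) atBot (𝓝 0) :=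
  Real.tendsto_exp_atBot.comp (tendsto_id.const_mul_atBot hk)

theorem tendsto_exp_neg_mul_atTop {k : ℝ} (hk : 0 < k) :
    Tendsto (fun x => Real.exp (-k * x)) atTop (𝓝 0) :=
  Real.tendsto_exp_atBot.comp (tendsto_id.const_mul_atTop_of_neg (neg_neg_of_pos hk))

theorem tendsto_mul_of_eventually_bounded {f g : ℝ → ℝ} {C : ℝ} {F : Filter ℝ}
    (hf : Tendsto f F (𝓝 0)) (hg : ∀ᶠ x in F, |g x| ≤ C) :
    Tendsto (fun x => f x * g x) F (𝓝 0) :=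
  hf.zero_mul_isBoundedUnder_le ⟨C, by simpa using hg⟩

/-! ### Comparison with the upper barriers -/

section Comparison

variable {α β Cφ Cv : ℝ} {φ v H : ℝ → ℝ}

theorem le_const_of_source_le (hα : 0 < α) (hβ : 0 < β)
    (hφ : ∀ x, HasDerivAt φ (β * φ x + v x) x) (hv : ∀ x, HasDerivAt v (-α * v x - H x) x)
    (hφb : ∀ x, |φ x| ≤ Cφ) (hvb : ∀ x, |v x| ≤ Cv) {k : ℝ} (hH : ∀ x, H x ≤ α * β * k)
    (x : ℝ) : φ x ≤ k := by
  have hφc : Continuous φ := continuous_iff_continuousAt.2 fun x => (hφ x).continuousAt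
  have hvc : Continuous v := continuous_iff_continuousAt.2 fun x => (hv x).continuousAt
  refine sub_nonneg.1 (nonneg_of_factorized_le (α := α) (β := β) (z := 0)
    (w := fun x => k - φ x) (v := fun x => -v x - β * k) (v' := fun x => α * v x + H x)
    (by fun_prop) (by fun_prop) (fun x _ => ?_) (fun x _ => ?_) (fun x _ => ?_) ?_ ?_ x)
  · exact ((hφ x).const_sub k).congr_deriv (by ring)
  · exact ((hv x).fun_neg.sub_const _).congr_deriv (by ring)
  · linarith [hH x]
  · refine tendsto_mul_of_eventually_bounded (C := Cv + |β * k|) (tendsto_exp_mul_atBot hα)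
      (Eventually.of_forall fun x => (abs_sub _ _).trans ?_)
    rw [abs_neg]
    linarith [hvb x]
  · refine tendsto_mul_of_eventually_bounded (C := |k| + Cφ) (tendsto_exp_neg_mul_atTop hβ)
      (Eventually.of_forall fun x => (abs_sub _ _).trans ?_)
    linarith [hφb x]

/-- (D + α)(D - β) maps e^{lx} to -(β - l)(l + α)e^{lx}; l < β gives the decay at +∞ required by the
maximum principle. -/
theorem le_exp_of_source_le (hα : 0 < α) (hβ : 0 < β)
    (hφ : ∀ x, HasDerivAt φ (β * φ x + v x) x) (hv : ∀ x, HasDerivAt v (-α * v x - H x) x)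
    (hφb : ∀ x, |φ x| ≤ Cφ) (hvb : ∀ x, |v x| ≤ Cv) {l : ℝ} (hl : 0 < l) (hlβ : l < β)
    (hH : ∀ x, H x ≤ (β - l) * (l + α) * Real.exp (l * x)) (x : ℝ) :
    φ x ≤ Real.exp (l * x) := by
  have hφc : Continuous φ := continuous_iff_continuousAt.2 fun x => (hφ x).continuousAt
  have hvc : Continuous v := continuous_iff_continuousAt.2 fun x => (hv x).continuousAt
  refine sub_nonneg.1 (nonneg_of_factorized_le (α := α) (β := β) (z := 0)
    (w := fun x => Real.exp (l * x) - φ x) (v := fun x => (l - β) * Real.exp (l * x) - v x)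
    (v' := fun x => (l - β) * (l * Real.exp (l * x)) + α * v x + H x)
    (by fun_prop) (by fun_prop) (fun x _ => ?_) (fun x _ => ?_) (fun x _ => ?_) ?_ ?_ x)
  · exact (hasDerivAt_exp_mul.sub (hφ x)).congr_deriv (by ring)
  · exact ((hasDerivAt_exp_mul.const_mul _).sub (hv x)).congr_deriv (by ring)
  · linarith [hH x]
  · refine tendsto_mul_of_eventually_bounded (C := |l - β| + Cv) (tendsto_exp_mul_atBot hα) ?_
    filter_upwards [eventually_le_atBot (0 : ℝ)] with x hx
    refine (abs_sub _ _).trans ?_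
    rw [abs_mul, Real.abs_exp]
    have : Real.exp (l * x) ≤ 1 :=
      Real.exp_le_one_iff.2 (mul_nonpos_of_nonneg_of_nonpos hl.le hx)
    linarith [hvb x, mul_le_mul_of_nonneg_left this (abs_nonneg (l - β))]
  · have h1 := (tendsto_exp_neg_mul_atTop (sub_pos.2 hlβ)).sub
      (tendsto_mul_of_eventually_bounded (tendsto_exp_neg_mul_atTop hβ)
        (Eventually.of_forall hφb))
    rw [sub_zero] at h1
    refine h1.congr fun x => ?_
    rw [mul_sub, ← Real.exp_add]
    ring_nf

end Comparison

/-! ### The lower barrier -/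

/-- The function `e^{l x} - q e^{ν x}` whose maximum is at `z`. -/
noncomputable def subExp (l ν z x : ℝ) : ℝ :=
  Real.exp (l * x) - l / ν * Real.exp ((l - ν) * z) * Real.exp (ν * x)

/-- The lower barrier: `subExp` up to its maximum, constant afterwards. -/
noncomputable def subBarrier (l ν z x : ℝ) : ℝ := subExp l ν z (min x z)

/-- The derivative of `subExp`. -/
noncomputable def subExpDeriv (l ν z x : ℝ) : ℝ :=
  l * Real.exp (l * x) - l * Real.exp ((l - ν) * z) * Real.exp (ν * x)

section SubBarrier

variable {l ν z : ℝ}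

theorem hasDerivAt_subExp (hν : ν ≠ 0) (x : ℝ) :
    HasDerivAt (subExp l ν z) (subExpDeriv l ν z x) x := by
  refine (hasDerivAt_exp_mul.sub (hasDerivAt_exp_mul.const_mul _)).congr_deriv ?_
  unfold subExpDeriv
  field_simp

theorem hasDerivAt_subExpDeriv (x : ℝ) :
    HasDerivAt (subExpDeriv l ν z) (l ^ 2 * Real.exp (l * x) -
      l * ν * Real.exp ((l - ν) * z) * Real.exp (ν * x)) x := by
  refine ((hasDerivAt_exp_mul.const_mul _).sub (hasDerivAt_exp_mul.const_mul _)).congr_deriv ?_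
  ring

/-- With e^{lx} factored out, the remaining factor is at most 1 left of z; positivity and
monotonicity of the barrier follow. -/
theorem exp_mul_exp_eq (l ν z x : ℝ) : Real.exp ((l - ν) * z) * Real.exp (ν * x) =
    Real.exp (l * x) * Real.exp ((l - ν) * (z - x)) := by
  rw [← Real.exp_add, ← Real.exp_add]
  ring_nf

theorem exp_shift_le_one (hlν : l < ν) {x : ℝ} (hx : x ≤ z) :
    Real.exp ((l - ν) * (z - x)) ≤ 1 :=
  Real.exp_le_one_iff.2 (mul_nonpos_of_nonpos_of_nonneg (by linarith) (by linarith))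

theorem subExpDeriv_nonneg (hl : 0 < l) (hlν : l < ν) {x : ℝ} (hx : x ≤ z) :
    0 ≤ subExpDeriv l ν z x := by
  unfold subExpDeriv
  rw [mul_assoc, exp_mul_exp_eq]
  have h1 := exp_shift_le_one hlν hx
  have h2 := mul_le_mul_of_nonneg_left h1 (mul_pos hl (Real.exp_pos (l * x))).le
  linarith

theorem subExpDeriv_le (hl : 0 < l) {x : ℝ} : subExpDeriv l ν z x ≤ l * Real.exp (l * x) := by
  unfold subExpDeriv
  have : 0 ≤ l * Real.exp ((l - ν) * z) * Real.exp (ν * x) := by positivity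
  linarith

theorem subExp_pos (hl : 0 < l) (hlν : l < ν) {x : ℝ} (hx : x ≤ z) : 0 < subExp l ν z x := by
  unfold subExp
  rw [mul_assoc, exp_mul_exp_eq]
  have h1 := exp_shift_le_one hlν hx
  have h2 : l / ν < 1 := (div_lt_one (hl.trans hlν)).2 hlν
  have h3 : 0 < l / ν := div_pos hl (hl.trans hlν)
  have h4 : l / ν * Real.exp ((l - ν) * (z - x)) < 1 :=
    (mul_le_of_le_one_right h3.le h1).trans_lt h2
  have := mul_lt_mul_of_pos_left h4 (Real.exp_pos (l * x))
  linarith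

theorem subExp_le (hl : 0 < l) (hlν : l < ν) {x : ℝ} : subExp l ν z x ≤ Real.exp (l * x) := by
  unfold subExp
  have : 0 ≤ l / ν * Real.exp ((l - ν) * z) * Real.exp (ν * x) := by
    have := hl.trans hlν
    positivity
  linarith

theorem continuous_subExp : Continuous (subExp l ν z) := by
  unfold subExp; fun_prop

theorem continuous_subExpDeriv : Continuous (subExpDeriv l ν z) := by
  unfold subExpDeriv; fun_prop

theorem continuous_subBarrier : Continuous (subBarrier l ν z) :=
  continuous_subExp.comp (continuous_id.min continuous_const)

theorem subBarrier_pos (hl : 0 < l) (hlν : l < ν) (x : ℝ) : 0 < subBarrier l ν z x :=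
  subExp_pos hl hlν (min_le_right _ _)

theorem subBarrier_le_exp (hl : 0 < l) (hlν : l < ν) (x : ℝ) :
    subBarrier l ν z x ≤ Real.exp (l * x) :=
  (subExp_le hl hlν).trans
    (Real.exp_le_exp.2 (mul_le_mul_of_nonneg_left (min_le_left _ _) hl.le))

theorem subBarrier_le_exp_peak (hl : 0 < l) (hlν : l < ν) (x : ℝ) :
    subBarrier l ν z x ≤ Real.exp (l * z) :=
  (subExp_le hl hlν).trans
    (Real.exp_le_exp.2 (mul_le_mul_of_nonneg_left (min_le_right _ _) hl.le))

theorem monotone_subBarrier (hl : 0 < l) (hlν : l < ν) : Monotone (subBarrier l ν z) := by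
  have h1 : MonotoneOn (subExp l ν z) (Iic z) := by
    refine monotoneOn_of_deriv_nonneg (convex_Iic z) continuous_subExp.continuousOn
      (fun x _ => (hasDerivAt_subExp (by linarith) x).differentiableAt.differentiableWithinAt) ?_
    intro x hx
    rw [(hasDerivAt_subExp (by linarith) x).deriv]
    exact subExpDeriv_nonneg hl hlν (mem_Iic.1 (interior_subset hx))
  exact fun x y hxy =>
    h1 (mem_Iic.2 (min_le_right _ _)) (mem_Iic.2 (min_le_right _ _)) (min_le_min_right z hxy)

theorem hasDerivAt_comp_min {f : ℝ → ℝ} {f' x : ℝ} (hf : HasDerivAt f f' x) (hx : x ≠ z) :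
    HasDerivAt (fun x => f (min x z)) (if x < z then f' else 0) x := by
  rcases lt_or_gt_of_ne hx with h | h
  · rw [if_pos h]
    refine hf.congr_of_eventuallyEq ?_
    filter_upwards [gt_mem_nhds h] with y hy
    rw [min_eq_left (le_of_lt hy)]
  · rw [if_neg h.not_gt]
    refine (hasDerivAt_const x (f z)).congr_of_eventuallyEq ?_
    filter_upwards [lt_mem_nhds h] with y hy
    rw [min_eq_right (le_of_lt hy)]

theorem subExpDeriv_peak : subExpDeriv l ν z z = 0 := by
  unfold subExpDeriv
  rw [mul_assoc, exp_mul_exp_eq]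
  simp

/-- The derivative of `subExp` vanishes at z, so the barrier is C¹ there and the `v`-component of
the difference stays continuous, as the maximum principle requires. -/
theorem subBarrier_le_of_le_source {α β Cφ Cv : ℝ} {φ v H : ℝ → ℝ} (hα : 0 < α) (hβ : 0 < β)
    (hφ : ∀ x, HasDerivAt φ (β * φ x + v x) x) (hv : ∀ x, HasDerivAt v (-α * v x - H x) x)
    (hφb : ∀ x, |φ x| ≤ Cφ) (hvb : ∀ x, |v x| ≤ Cv) (hl : 0 < l) (hlν : l < ν)
    (hH : ∀ x < z, -((l ^ 2 - (β - α) * l - α * β) * Real.exp (l * x) -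
      l / ν * Real.exp ((l - ν) * z) * ((ν ^ 2 - (β - α) * ν - α * β) * Real.exp (ν * x)))
        ≤ H x)
    (hH' : ∀ x, z < x → α * β * subExp l ν z z ≤ H x) (x : ℝ) :
    subBarrier l ν z x ≤ φ x := by
  have hν : ν ≠ 0 := by linarith
  have hφc : Continuous φ := continuous_iff_continuousAt.2 fun x => (hφ x).continuousAt
  have hvc : Continuous v := continuous_iff_continuousAt.2 fun x => (hv x).continuousAt
  have hsc := continuous_subBarrier (l := l) (ν := ν) (z := z)
  have hmin : Continuous fun x : ℝ => min x z := by fun_prop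
  have hdc : Continuous fun x => subExpDeriv l ν z (min x z) :=
    continuous_subExpDeriv.comp hmin
  have hb : ∀ x, |subBarrier l ν z x| ≤ Real.exp (l * z) := fun x => by
    rw [abs_of_pos (subBarrier_pos hl hlν x)]
    exact subBarrier_le_exp_peak hl hlν x
  have hb' : ∀ x, |subExpDeriv l ν z (min x z)| ≤ l * Real.exp (l * z) := fun x => by
    rw [abs_of_nonneg (subExpDeriv_nonneg hl hlν (min_le_right _ _))]
    exact (subExpDeriv_le hl).trans (mul_le_mul_of_nonneg_left
      (Real.exp_le_exp.2 (mul_le_mul_of_nonneg_left (min_le_right _ _) hl.le)) hl.le)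
  refine sub_nonneg.1 (nonneg_of_factorized_le (α := α) (β := β) (z := z)
    (w := fun x => φ x - subBarrier l ν z x)
    (v := fun x => v x - (subExpDeriv l ν z (min x z) - β * subBarrier l ν z x))
    (v' := fun x => -α * v x - H x -
      ((if x < z then l ^ 2 * Real.exp (l * x) -
        l * ν * Real.exp ((l - ν) * z) * Real.exp (ν * x) else 0) -
        β * (if x < z then subExpDeriv l ν z x else 0)))
    (by fun_prop) (by fun_prop) (fun x hx => ?_) (fun x hx => ?_) (fun x hx => ?_) ?_ ?_ x)
  · refine ((hφ x).sub (hasDerivAt_comp_min (hasDerivAt_subExp hν x) hx)).congr_deriv ?_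
    split_ifs with h
    · rw [min_eq_left h.le]; ring
    · rw [min_eq_right (not_lt.1 h), subExpDeriv_peak]; ring
  · exact (hv x).sub ((hasDerivAt_comp_min (hasDerivAt_subExpDeriv x) hx).sub
      ((hasDerivAt_comp_min (hasDerivAt_subExp hν x) hx).const_mul β))
  · rcases lt_or_gt_of_ne hx with h | h
    · simp only [if_pos h, min_eq_left h.le, subBarrier]
      have := hH x h
      have e : l / ν * Real.exp ((l - ν) * z) *
          ((ν ^ 2 - (β - α) * ν - α * β) * Real.exp (ν * x)) =
          (l * ν - (β - α) * l) * Real.exp ((l - ν) * z) * Real.exp (ν * x) -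
          α * β * (l / ν * Real.exp ((l - ν) * z) * Real.exp (ν * x)) := by
        field_simp
      rw [e] at this
      unfold subExp subExpDeriv
      linarith
    · simp only [if_neg h.not_gt, min_eq_right h.le, subBarrier, subExpDeriv_peak]
      linarith [hH' x h]
  · refine tendsto_mul_of_eventually_bounded
      (C := Cv + (l * Real.exp (l * z) + β * Real.exp (l * z))) (tendsto_exp_mul_atBot hα)
      (Eventually.of_forall fun x => ?_)
    refine (abs_sub _ _).trans (add_le_add (hvb x) ((abs_sub _ _).trans
      (add_le_add (hb' x) ?_)))
    rw [abs_mul, abs_of_pos hβ]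
    exact mul_le_mul_of_nonneg_left (hb x) hβ.le
  · exact tendsto_mul_of_eventually_bounded (C := Cφ + Real.exp (l * z))
      (tendsto_exp_neg_mul_atTop hβ)
      (Eventually.of_forall fun x => (abs_sub _ _).trans (add_le_add (hφb x) (hb x)))

/-- The differential inequality for the lower barrier. The argument of `subExp` on the right
allows for a delay between `m` and `m + e^{l x}`. -/
theorem subExp_source_ge {c d p m L x : ℝ} (hc : 0 < c) (hp : 0 ≤ p) (hm : 0 ≤ m)
    (hl : 0 < l) (hlν : l < ν) (hν : ν ≤ 2 * l) (hL : 0 ≤ L) (h0 : charFun d p m l c = 0)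
    (hz0 : z ≤ 0)
    (hz : p * l * c + L ≤ l / ν * -charFun d p m ν c * Real.exp ((l - ν) * z)) (hx : x ≤ z) :
    -((l ^ 2 - c * l - d) * Real.exp (l * x) -
      l / ν * Real.exp ((l - ν) * z) * ((ν ^ 2 - c * ν - d) * Real.exp (ν * x))) ≤
    p * subExp l ν z (x - c * m - c * Real.exp (l * x)) -
      L * subExp l ν z (x - c * m - c * Real.exp (l * x)) ^ 2 := by
  set η := x - c * m - c * Real.exp (l * x) with hη
  have hν0 : 0 < ν := hl.trans hlν
  have hcm : 0 ≤ c * m := by positivity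
  have hηx : η ≤ x := by
    have := mul_pos hc (Real.exp_pos (l * x))
    linarith
  set X := Real.exp (l * x) with hX
  set Y := Real.exp (ν * x) with hY
  set a := Real.exp (-(l * c * m)) with ha
  set a' := Real.exp (-(ν * c * m)) with ha'
  set q := l / ν * Real.exp ((l - ν) * z) with hq
  have hq0 : 0 ≤ q := by positivity
  have hX0 : 0 < X := Real.exp_pos _
  have hY0 : 0 < Y := Real.exp_pos _
  have ha0 : 0 < a := Real.exp_pos _
  have ha1 : a ≤ 1 := Real.exp_le_one_iff.2 (by nlinarith)
  have hE0 : 0 ≤ subExp l ν z η := (subExp_pos hl hlν (hηx.trans hx)).le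
  have hEX : subExp l ν z η ≤ X := (subExp_le hl hlν).trans
    (Real.exp_le_exp.2 (mul_le_mul_of_nonneg_left hηx hl.le))
  -- The extra delay c e^{lx} costs only a quadratic term in X = e^{lx}, by 1 + t ≤ e^t.
  have h1 : X * a - l * c * X ^ 2 ≤ Real.exp (l * η) := by
    have e : Real.exp (l * η) = X * a * Real.exp (-(l * c * X)) := by
      rw [hη, hX, ha, ← Real.exp_add, ← Real.exp_add]
      ring_nf
    rw [e]
    have h2 := Real.add_one_le_exp (-(l * c * X))
    have h3 := mul_le_mul_of_nonneg_left h2 (mul_pos hX0 ha0).le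
    have h4 : 0 ≤ l * c * X ^ 2 := by positivity
    nlinarith [mul_nonneg h4 (sub_nonneg.2 ha1)]
  have h2 : Real.exp (ν * η) ≤ Y * a' := by
    rw [hY, ha', ← Real.exp_add]
    refine Real.exp_le_exp.2 ?_
    have := mul_nonneg hν0.le (mul_nonneg hc.le hX0.le)
    rw [hη]
    linarith
  have h3 : X * a - l * c * X ^ 2 - q * (Y * a') ≤ subExp l ν z η :=
    sub_le_sub h1 (mul_le_mul_of_nonneg_left h2 hq0)
  have h4 : X ^ 2 ≤ Y := by
    rw [hX, hY, ← Real.exp_nat_mul]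
    refine Real.exp_le_exp.2 ?_
    push_cast
    nlinarith
  -- The gain from Λ(ν, c) < 0 absorbs both quadratic losses; X² ≤ Y uses ν ≤ 2l and x ≤ 0.
  have h5 : (p * l * c + L) * X ^ 2 ≤ q * -charFun d p m ν c * Y := by
    have : l / ν * -charFun d p m ν c * Real.exp ((l - ν) * z) = q * -charFun d p m ν c := by
      rw [hq]; ring
    rw [this] at hz
    exact mul_le_mul hz h4 (by positivity) (le_trans (by positivity) hz)
  have h6 : L * subExp l ν z η ^ 2 ≤ L * X ^ 2 :=
    mul_le_mul_of_nonneg_left (pow_le_pow_left₀ hE0 hEX 2) hL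
  have h7 := mul_le_mul_of_nonneg_left h3 hp
  have e1 : l ^ 2 - c * l - d = -(p * a) := by
    unfold charFun at h0
    linarith
  have e2 : ν ^ 2 - c * ν - d = charFun d p m ν c - p * a' := by
    unfold charFun
    ring
  rw [e1, e2]
  linarith

/-- At the maximum the first derivative is 0 and the second is nonpositive, so the constant
continuation requires no more source than the barrier does at z. -/
theorem const_source_le_peak (hl : 0 < l) (hlν : l < ν) (c d : ℝ) :
    d * subExp l ν z z ≤ -((l ^ 2 - c * l - d) * Real.exp (l * z) -
      l / ν * Real.exp ((l - ν) * z) * ((ν ^ 2 - c * ν - d) * Real.exp (ν * z))) := by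
  have hν0 : 0 < ν := hl.trans hlν
  have e : Real.exp ((l - ν) * z) * Real.exp (ν * z) = Real.exp (l * z) := by
    rw [← Real.exp_add]; ring_nf
  have e1 : l / ν * Real.exp ((l - ν) * z) * ((ν ^ 2 - c * ν - d) * Real.exp (ν * z)) =
      l / ν * (ν ^ 2 - c * ν - d) * Real.exp (l * z) := by
    rw [← e]; ring
  have e2 : l / ν * (ν ^ 2 - c * ν - d) = l * ν - c * l - d * (l / ν) := by field_simp
  have e3 : subExp l ν z z = (1 - l / ν) * Real.exp (l * z) := by
    unfold subExp
    rw [mul_assoc, e]; ring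
  rw [e1, e2, e3]
  have : 0 ≤ (ν - l) * l * Real.exp (l * z) :=
    mul_nonneg (mul_nonneg (by linarith) hl.le) (Real.exp_nonneg _)
  linarith

end SubBarrier

/-! ### Characteristic values -/

theorem continuous_charFun (d p m c : ℝ) : Continuous fun l => charFun d p m l c := by
  unfold charFun; fun_prop

/-- Some slower speed has a positive zero l₀, and Λ(l₀, ·) is strictly decreasing, so Λ(l₀, c) < 0.
The last point l of [0, l₀] with Λ ≥ 0 is a zero, and Λ < 0 on (l, l₀]. This leaves room for ν ≤ 2l.
-/
theorem exists_charFun_roots {d p m c : ℝ} (hd : 0 < d) (hp : d < p) (hm : 0 ≤ m)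
    (hc : criticalSpeed d p m < c) :
    0 < c ∧ ∃ l ν, 0 < l ∧ l < ν ∧ ν ≤ 2 * l ∧ charFun d p m l c = 0 ∧
      charFun d p m ν c < 0 := by
  have hzero : ∀ c, charFun d p m 0 c = p - d := fun c => by simp [charFun]; ring
  have hne : {c : ℝ | 0 < c ∧ ∃ lam : ℝ, 0 < lam ∧ charFun d p m lam c = 0}.Nonempty := by
    -- At this speed Λ(1) ≤ -d < 0, while Λ(0) = p - d > 0.
    refine ⟨1 + p, by linarith, ?_⟩
    have h1 : charFun d p m 1 (1 + p) ≤ 0 := by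
      have : Real.exp (-(1 * (1 + p) * m)) ≤ 1 :=
        Real.exp_le_one_iff.2 (by nlinarith)
      unfold charFun
      nlinarith
    obtain ⟨x, hx, hx0⟩ := intermediate_value_Icc' zero_le_one
      (continuous_charFun d p m (1 + p)).continuousOn ⟨h1, by rw [hzero]; linarith⟩
    refine ⟨x, lt_of_le_of_ne hx.1 ?_, hx0⟩
    rintro rfl
    linarith [(hzero (1 + p)).symm.trans hx0]
  obtain ⟨c₀, ⟨hc₀, l₀, hl₀, h₀⟩, hlt⟩ := exists_lt_of_csInf_lt hne hc
  have hneg : charFun d p m l₀ c < 0 := by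
    rw [← h₀]
    unfold charFun
    have h1 : l₀ * c₀ < l₀ * c := mul_lt_mul_of_pos_left hlt hl₀
    have h2 : Real.exp (-(l₀ * c * m)) ≤ Real.exp (-(l₀ * c₀ * m)) :=
      Real.exp_le_exp.2 (neg_le_neg (mul_le_mul_of_nonneg_right h1.le hm))
    nlinarith
  refine ⟨hc₀.trans hlt, ?_⟩
  have hcpt : IsCompact (Icc 0 l₀ ∩ {x | 0 ≤ charFun d p m x c}) :=
    isCompact_Icc.inter_right (isClosed_le continuous_const (continuous_charFun d p m c))
  obtain ⟨l, ⟨hlI, hl0⟩, hmax⟩ := hcpt.exists_isGreatest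
    ⟨0, ⟨le_rfl, hl₀.le⟩, by rw [mem_ofPred_eq, hzero]; linarith⟩
  rw [mem_ofPred_eq] at hl0
  have hll : l < l₀ := lt_of_le_of_ne hlI.2 (by rintro rfl; linarith)
  have hroot : charFun d p m l c = 0 := by
    obtain ⟨y, hy, hy0⟩ := intermediate_value_Icc' hll.le
      (continuous_charFun d p m c).continuousOn ⟨hneg.le, hl0⟩
    have : y ≤ l := hmax ⟨⟨hlI.1.trans hy.1, hy.2⟩, hy0.ge⟩
    rwa [le_antisymm this hy.1] at hy0
  have hlpos : 0 < l := lt_of_le_of_ne hlI.1 (by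
    rintro rfl
    rw [hzero] at hroot
    linarith)
  have hν : l < min (2 * l) l₀ := lt_min (by linarith) hll
  refine ⟨l, min (2 * l) l₀, hlpos, hν, min_le_left _ _, hroot, ?_⟩
  by_contra! h
  exact absurd (hmax ⟨⟨(hlpos.trans hν).le, min_le_right _ _⟩, h⟩) (not_le.2 hν)

theorem exists_factorization {c d : ℝ} (hd : 0 < d) :
    ∃ α β : ℝ, 0 < α ∧ 0 < β ∧ c = β - α ∧ d = α * β := by
  have h1 : 0 ≤ c ^ 2 + 4 * d := by positivity
  have hs := Real.sq_sqrt h1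
  have hc : |c| < Real.sqrt (c ^ 2 + 4 * d) := by
    rw [← Real.sqrt_sq_eq_abs]
    exact Real.sqrt_lt_sqrt (sq_nonneg c) (by linarith)
  rw [abs_lt] at hc
  exact ⟨(-c + Real.sqrt (c ^ 2 + 4 * d)) / 2, (c + Real.sqrt (c ^ 2 + 4 * d)) / 2,
    by linarith, by linarith, by ring, by nlinarith⟩

/-! ### Consequences of the assumptions on the birth function and the delay -/

section Assumptions

variable {d K M : ℝ} {b τ : ℝ → ℝ}

theorem IsBirthFunction.pos (hB : IsBirthFunction d K b) (hd : 0 < d) (hK : 0 < K) {u : ℝ}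
    (hu : 0 < u) : 0 < b u := by
  rcases lt_trichotomy u K with h | h | h
  · exact (mul_pos hd hu).trans (hB.gt_below u hu h)
  · rw [h, hB.equilibrium]
    exact mul_pos hd hK
  · exact hB.pos_above u h

/-- Take k as the larger of K and max b / d over [0, K]; above K, b(u) < du ≤ dk. -/
theorem IsBirthFunction.exists_invariant_bound (hB : IsBirthFunction d K b) (hd : 0 < d)
    (hK : 0 < K) (hb : ContinuousOn b (Ici 0)) :
    ∃ k, 0 < k ∧ ∀ u, 0 ≤ u → u ≤ k → b u ≤ d * k := by
  obtain ⟨u₀, hu₀, hmax⟩ := isCompact_Icc.exists_isMaxOn (nonempty_Icc.2 hK.le)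
    (hb.mono (Icc_subset_Ici_self (a := K) (b := (0 : ℝ))))
  refine ⟨max K (b u₀ / d), hK.trans_le (le_max_left _ _), fun u hu huk => ?_⟩
  rcases le_or_gt u K with h | h
  · have h1 : b u ≤ b u₀ := hmax ⟨hu, h⟩
    have h2 : b u₀ / d ≤ max K (b u₀ / d) := le_max_right _ _
    rw [div_le_iff₀ hd] at h2
    linarith
  · exact (hB.lt_above u h).le.trans (mul_le_mul_of_nonneg_left huk hd.le)

/-- Enlarging L to at least b'(0)/K makes the parabola nonpositive beyond K, where b ≥ 0 suffices.
-/
theorem IsNonmonotoneBirth.exists_quadratic_lower (hB : IsBirthFunction d K b)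
    (hC : IsNonmonotoneBirth d K b) (hd : 0 < d) (hK : 0 < K) :
    ∃ L, 0 < L ∧ ∀ u, 0 ≤ u → halfDeriv b 0 * u - L * u ^ 2 ≤ b u := by
  obtain ⟨L, hL, hq⟩ := hC.quadratic
  have hp := hd.trans hC.deriv_zero_gt
  refine ⟨max L (halfDeriv b 0 / K), lt_max_of_lt_left hL, fun u hu => ?_⟩
  have h1 := mul_le_mul_of_nonneg_right (le_max_left L (halfDeriv b 0 / K)) (sq_nonneg u)
  have h2 := mul_le_mul_of_nonneg_right (le_max_right L (halfDeriv b 0 / K)) (sq_nonneg u)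
  rcases hu.eq_or_lt with rfl | hu
  · simp [hB.zero]
  rcases le_or_gt u K with h | h
  · linarith [(hq u hu h).2]
  · have h3 : halfDeriv b 0 * u ≤ halfDeriv b 0 / K * u ^ 2 := by
      rw [div_mul_eq_mul_div, le_div_iff₀ hK]
      nlinarith [mul_pos hp hu]
    linarith [hB.nonneg u hu.le]

/-- A nondecreasing minorant of `b` near `0`. -/
theorem IsBirthFunction.exists_monotone_lower (hB : IsBirthFunction d K b) (hd : 0 < d)
    (hK : 0 < K) (hb : ContinuousOn b (Ici 0)) {p L k : ℝ} (hp : 0 < p) (hL : 0 < L)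
    (hlow : ∀ u, 0 ≤ u → p * u - L * u ^ 2 ≤ b u) :
    ∃ u₀, 0 < u₀ ∧ ∀ y t, 0 ≤ y → y ≤ u₀ → y ≤ t → t ≤ k → p * y - L * y ^ 2 ≤ b t := by
  -- This is the vertex of the parabola: left of it the parabola increases, and right of it b has a
  -- positive minimum m up to k. Taking u₀ = m / p keeps py below m.
  have ht₀ : 0 < p / (2 * L) := by positivity
  obtain ⟨m, hm, hmin⟩ : ∃ m, 0 < m ∧ ∀ t ∈ Icc (p / (2 * L)) k, m ≤ b t := by
    rcases (Icc (p / (2 * L)) k).eq_empty_or_nonempty with h | h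
    · exact ⟨1, one_pos, by simp [h]⟩
    · obtain ⟨t₁, ht₁, hmin⟩ := isCompact_Icc.exists_isMinOn h
        (hb.mono fun t ht => ht₀.le.trans ht.1)
      exact ⟨b t₁, hB.pos hd hK (ht₀.trans_le ht₁.1), fun t ht => hmin ht⟩
  refine ⟨m / p, by positivity, fun y t hy hyu hyt htk => ?_⟩
  rcases le_or_gt t (p / (2 * L)) with h | h
  · refine le_trans ?_ (hlow t (hy.trans hyt))
    rw [le_div_iff₀ (by positivity)] at h
    nlinarith [mul_nonneg (sub_nonneg.2 hyt) (by nlinarith : 0 ≤ p - L * (t + y))]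
  · refine le_trans ?_ (hmin t ⟨h.le, htk⟩)
    rw [le_div_iff₀ hp] at hyu
    have : 0 ≤ L * y ^ 2 := by positivity
    linarith

theorem IsNonmonotoneBirth.le_linear (hB : IsBirthFunction d K b)
    (hC : IsNonmonotoneBirth d K b) {u : ℝ} (hu : 0 ≤ u) : b u ≤ halfDeriv b 0 * u := by
  rcases hu.eq_or_lt with rfl | hu
  · simp [hB.zero]
  · exact (hC.lt_linear u hu).le

theorem IsDelay.hasDerivAt (hA : IsDelay M τ) {u : ℝ} (hu : 0 < u) :
    HasDerivAt τ (halfDeriv τ u) u :=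
  ((hA.contDiffOn.differentiableOn one_ne_zero u hu.le).hasDerivWithinAt).hasDerivAt
    (Ici_mem_nhds hu)

theorem IsDelay.monotoneOn (hA : IsDelay M τ) : MonotoneOn τ (Ici 0) := by
  refine monotoneOn_of_deriv_nonneg (convex_Ici 0) hA.contDiffOn.continuousOn ?_ ?_ <;>
    rw [interior_Ici]
  · exact fun x hx => (hA.hasDerivAt hx).differentiableAt.differentiableWithinAt
  · intro x hx
    rw [(hA.hasDerivAt hx).deriv]
    exact hA.deriv_nonneg x (le_of_lt hx)

theorem IsDelay.zero_le (hA : IsDelay M τ) {u : ℝ} (hu : 0 ≤ u) : τ 0 ≤ τ u :=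
  hA.monotoneOn self_mem_Ici hu hu

theorem IsDelay.le_limit (hA : IsDelay M τ) {u : ℝ} (hu : 0 ≤ u) : τ u ≤ M := by
  refine ge_of_tendsto hA.tendsto ?_
  filter_upwards [eventually_ge_atTop u] with t ht
  exact hA.monotoneOn hu (hu.trans ht) ht

theorem IsDelay.le_add (hA : IsDelay M τ) {u : ℝ} (hu : 0 ≤ u) : τ u ≤ τ 0 + u := by
  have : AntitoneOn (fun u => τ u - u) (Ici 0) := by
    refine antitoneOn_of_deriv_nonpos (convex_Ici 0)
      (hA.contDiffOn.continuousOn.sub continuousOn_id) ?_ ?_ <;> rw [interior_Ici]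
    · exact fun x hx =>
        ((hA.hasDerivAt hx).sub (hasDerivAt_id x)).differentiableAt.differentiableWithinAt
    · intro x hx
      have := ((hA.hasDerivAt hx).sub (hasDerivAt_id x)).deriv
      have h2 : deriv (fun u => τ u - u) x = halfDeriv τ x - 1 := this
      rw [h2]
      linarith [hA.deriv_lt_one x (le_of_lt hx)]
  have h := this self_mem_Ici (show u ∈ Ici 0 from hu) hu
  simp only [sub_zero] at h
  linarith

/-- The delayed argument stays to the right of a nondecreasing function of `x`. -/
theorem IsDelay.le_delayed_arg (hA : IsDelay M τ) {c l z s : ℝ} (hc : 0 < c) (hl : 0 < l)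
    (hs : c * l * Real.exp (l * s) ≤ 1) (hz : z ≤ s - c * M) {x u : ℝ} (hu : 0 ≤ u)
    (hux : u ≤ Real.exp (l * x)) :
    min x z - c * τ 0 - c * Real.exp (l * min x z) ≤ x - c * τ u := by
  have h1 : c * τ u ≤ c * τ 0 + c * Real.exp (l * x) := by
    have := mul_le_mul_of_nonneg_left ((hA.le_add hu).trans (add_le_add_right hux _)) hc.le
    linarith
  rcases le_total x z with h | h
  · rw [min_eq_left h]
    linarith
  rw [min_eq_right h]
  -- Up to s the map x ↦ x - c e^{lx} is nondecreasing; beyond s the bound τ ≤ M already keeps the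
  -- argument to the right of z.
  rcases le_total x s with hxs | hxs
  · have h2 : Real.exp (l * x) - Real.exp (l * z) ≤ Real.exp (l * x) * (l * (x - z)) := by
      have e : Real.exp (l * z) = Real.exp (l * x) * Real.exp (-(l * (x - z))) := by
        rw [← Real.exp_add]; ring_nf
      have := mul_le_mul_of_nonneg_left (Real.add_one_le_exp (-(l * (x - z))))
        (Real.exp_nonneg (l * x))
      rw [e]
      linarith
    have h3 : c * l * Real.exp (l * x) ≤ 1 := le_trans (mul_le_mul_of_nonneg_left
      (Real.exp_le_exp.2 (mul_le_mul_of_nonneg_left hxs hl.le)) (by positivity)) hs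
    have h4 := mul_le_mul_of_nonneg_right h3 (sub_nonneg.2 h)
    have h5 := mul_le_mul_of_nonneg_left h2 hc.le
    linarith
  · have h2 := mul_le_mul_of_nonneg_left (hA.le_limit hu) hc.le
    have h3 := mul_nonneg hc.le (hA.nonneg 0 le_rfl)
    have h4 := mul_pos hc (Real.exp_pos (l * z))
    linarith

end Assumptions

/-! ### Choice of the peak, truncation and conclusion -/

theorem exists_peak {l ν κ u₀ k s A : ℝ} (hl : 0 < l) (hlν : l < ν) (hκ : 0 < κ)
    (hu₀ : 0 < u₀) (hk : 0 < k) :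
    ∃ z ≤ 0, z ≤ s ∧ A ≤ l / ν * κ * Real.exp ((l - ν) * z) ∧ Real.exp (l * z) ≤ u₀ ∧
      Real.exp (l * z) ≤ k := by
  have hq : 0 < l / ν * κ := mul_pos (div_pos hl (hl.trans hlν)) hκ
  -- Since l < ν, moving the peak to -∞ enlarges the coefficient of e^{νx} without bound while the
  -- barrier height tends to 0.
  have h1 : Tendsto (fun z => l / ν * κ * Real.exp ((l - ν) * z)) atBot atTop :=
    (Real.tendsto_exp_atTop.comp
      (tendsto_id.const_mul_atBot_of_neg (sub_neg.2 hlν))).const_mul_atTop hq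
  have h2 := tendsto_exp_mul_atBot hl
  obtain ⟨z, hz⟩ := ((eventually_le_atBot (0 : ℝ)).and ((eventually_le_atBot s).and
    ((h1.eventually_ge_atTop A).and ((h2.eventually (ge_mem_nhds hu₀)).and
      (h2.eventually (ge_mem_nhds hk)))))).exists
  exact ⟨z, hz.1, hz.2⟩

/-- A solution of the factorized system is twice continuously differentiable. -/
theorem contDiff_two_of_factorized {α β : ℝ} {φ v H : ℝ → ℝ}
    (hφ : ∀ x, HasDerivAt φ (β * φ x + v x) x) (hv : ∀ x, HasDerivAt v (-α * v x - H x) x)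
    (hH : Continuous H) : ContDiff ℝ 2 φ := by
  have hφd : deriv φ = fun x => β * φ x + v x := funext fun x => (hφ x).deriv
  have hvd : deriv v = fun x => -α * v x - H x := funext fun x => (hv x).deriv
  have hφ' : Differentiable ℝ φ := fun x => (hφ x).differentiableAt
  have hv' : Differentiable ℝ v := fun x => (hv x).differentiableAt
  have hφc := hφ'.continuous
  have hvc := hv'.continuous
  have h1 : ContDiff ℝ 1 v := contDiff_one_iff_deriv.2 ⟨hv', by rw [hvd]; fun_prop⟩
  have h2 : ContDiff ℝ 1 φ := contDiff_one_iff_deriv.2 ⟨hφ', by rw [hφd]; fun_prop⟩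
  have h3 : ContDiff ℝ (1 + 1) φ := by
    refine contDiff_succ_iff_deriv.2 ⟨hφ', by simp, ?_⟩
    rw [hφd]
    fun_prop
  exact h3

/-- The truncation of `u` to the interval between the lower and the upper barrier. -/
noncomputable def barrierClamp (l ν z k x u : ℝ) : ℝ :=
  max (subBarrier l ν z x) (min (min k (Real.exp (l * x))) u)

section Clamp

variable {l ν z k : ℝ}

theorem continuous_barrierClamp :
    Continuous fun q : ℝ × ℝ => barrierClamp l ν z k q.1 q.2 := by
  have := (continuous_subBarrier (l := l) (ν := ν) (z := z)).comp (continuous_fst (Y := ℝ))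
  unfold barrierClamp
  exact this.max (by fun_prop)

theorem barrierClamp_pos (hl : 0 < l) (hlν : l < ν) (x u : ℝ) : 0 < barrierClamp l ν z k x u :=
  (subBarrier_pos hl hlν x).trans_le (le_max_left _ _)

theorem barrierClamp_le_exp (hl : 0 < l) (hlν : l < ν) (x u : ℝ) :
    barrierClamp l ν z k x u ≤ Real.exp (l * x) :=
  max_le (subBarrier_le_exp hl hlν x) ((min_le_left _ _).trans (min_le_right _ _))

theorem barrierClamp_le (hl : 0 < l) (hlν : l < ν) (hz : Real.exp (l * z) ≤ k) (x u : ℝ) :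
    barrierClamp l ν z k x u ≤ k :=
  max_le ((subBarrier_le_exp_peak hl hlν x).trans hz)
    ((min_le_left _ _).trans (min_le_left _ _))

theorem barrierClamp_eq {x u : ℝ} (h1 : subBarrier l ν z x ≤ u) (h2 : u ≤ k)
    (h3 : u ≤ Real.exp (l * x)) : barrierClamp l ν z k x u = u := by
  unfold barrierClamp
  rw [min_eq_right (le_min h2 h3), max_eq_right h1]

end Clamp

/-- There is a wave profile between a positive, eventually constant lower barrier and the
exponential upper barrier. -/
theorem exists_waveProfile_between {d K M c : ℝ} (hd : 0 < d) (hK : 0 < K) {b τ : ℝ → ℝ}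
    (hB : IsBirthFunction d K b) (hA : IsDelay M τ) (hC : IsNonmonotoneBirth d K b)
    (hc : criticalSpeed d (halfDeriv b 0) (τ 0) < c) :
    ∃ (φ : ℝ → ℝ) (l ν z k : ℝ), 0 < l ∧ l < ν ∧ IsWaveProfile d b τ c φ ∧
      ∀ x, subBarrier l ν z x ≤ φ x ∧ φ x ≤ k ∧ φ x ≤ Real.exp (l * x) := by
  have hm : 0 ≤ τ 0 := hA.nonneg 0 le_rfl
  have hp : 0 < halfDeriv b 0 := hd.trans hC.deriv_zero_gt
  obtain ⟨hc0, l, ν, hl, hlν, hν, hroot, hneg⟩ :=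
    exists_charFun_roots hd hC.deriv_zero_gt hm hc
  have hbc := hC.contDiffOn.continuousOn
  obtain ⟨k, hk, hbk⟩ := hB.exists_invariant_bound hd hK hbc
  obtain ⟨L, hL, hlow⟩ := hC.exists_quadratic_lower hB hd hK
  obtain ⟨u₀, hu₀, hmono⟩ := hB.exists_monotone_lower (k := k) hd hK hbc hp hL hlow
  obtain ⟨s, hs⟩ : ∃ s, c * l * Real.exp (l * s) ≤ 1 := by
    have h := (tendsto_exp_mul_atBot hl).const_mul (c * l)
    rw [mul_zero] at h
    exact (h.eventually (ge_mem_nhds one_pos)).exists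
  obtain ⟨z, hz0, hzs, hzA, hzu, hzk⟩ := exists_peak (s := s - c * M)
    (A := halfDeriv b 0 * l * c + L) hl hlν (neg_pos.2 hneg) hu₀ hk
  obtain ⟨α, β, hα, hβ, hcαβ, hdαβ⟩ := exists_factorization (c := c) hd
  let P : ℝ → ℝ → ℝ := barrierClamp l ν z k
  have hPc : Continuous fun q : ℝ × ℝ => P q.1 q.2 := continuous_barrierClamp
  have hP0 : ∀ x u, 0 < P x u := barrierClamp_pos hl hlν
  have hPexp : ∀ x u, P x u ≤ Real.exp (l * x) := barrierClamp_le_exp hl hlν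
  have hPk : ∀ x u, P x u ≤ k := barrierClamp_le hl hlν hzk
  let T : ℝ → ℝ → ℝ := fun x u => c * τ (P x u)
  let G : ℝ → ℝ → ℝ := fun x u => b (P x u)
  have hT : Continuous fun q : ℝ × ℝ => T q.1 q.2 := continuous_const.mul
    (hA.contDiffOn.continuousOn.comp_continuous hPc fun q => (hP0 _ _).le)
  have hG : Continuous fun q : ℝ × ℝ => G q.1 q.2 :=
    hbc.comp_continuous hPc fun q => (hP0 _ _).le
  have hT0 : ∀ x u, 0 ≤ T x u := fun x u => mul_nonneg hc0.le (hA.nonneg _ (hP0 x u).le)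
  have hGk : ∀ x u, G x u ≤ d * k := fun x u => hbk _ (hP0 x u).le (hPk x u)
  have hGb : ∀ x u, |G x u| ≤ d * k := fun x u => by
    rw [abs_of_nonneg (hB.nonneg _ (hP0 x u).le)]
    exact hGk x u
  obtain ⟨φ, v, hφ, hv, hφb, hvb⟩ := exists_bounded_solution hT hG hT0 hGb hα hβ
  have hφc : Continuous φ := continuous_iff_continuousAt.2 fun x => (hφ x).continuousAt
  have hup : ∀ x, φ x ≤ k := le_const_of_source_le hα hβ hφ hv hφb hvb fun x => by
    rw [← hdαβ]
    exact hGk _ _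
  -- This is Λ(l, c) = 0 in factorized form; positivity of the right side gives l < β.
  have hchar : (β - l) * (l + α) = halfDeriv b 0 * Real.exp (-(l * c * τ 0)) := by
    unfold charFun at hroot
    rw [hdαβ] at hroot
    have : (l : ℝ) ^ 2 - c * l - α * β = -((β - l) * (l + α)) := by rw [hcαβ]; ring
    linarith
  have hlβ : l < β := by
    have h1 : 0 < (β - l) * (l + α) := by
      rw [hchar]
      exact mul_pos hp (Real.exp_pos _)
    exact sub_pos.1 (pos_of_mul_pos_left h1 (by linarith))
  have hexp : ∀ x, φ x ≤ Real.exp (l * x) :=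
    le_exp_of_source_le hα hβ hφ hv hφb hvb hl hlβ fun x => by
      rw [hchar, mul_assoc, ← Real.exp_add]
      refine (hC.le_linear hB (hP0 _ _).le).trans
        (mul_le_mul_of_nonneg_left ((hPexp _ _).trans (Real.exp_le_exp.2 ?_)) hp.le)
      have h1 : c * τ 0 ≤ T x (φ x) :=
        mul_le_mul_of_nonneg_left (hA.zero_le (hP0 x (φ x)).le) hc0.le
      have h2 := mul_le_mul_of_nonneg_left h1 hl.le
      linarith
  -- Stated at `min x z`, one inequality serves both the exponential and the constant piece of the
  -- barrier.
  have hsource : ∀ x, -((l ^ 2 - c * l - d) * Real.exp (l * min x z) -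
      l / ν * Real.exp ((l - ν) * z) * ((ν ^ 2 - c * ν - d) * Real.exp (ν * min x z))) ≤
      G (x - T x (φ x)) (φ (x - T x (φ x))) := fun x => by
    refine (subExp_source_ge hc0 hp.le hm hl hlν hν hL.le hroot hz0 hzA
      (min_le_right x z)).trans ?_
    have hη : min x z - c * τ 0 - c * Real.exp (l * min x z) ≤ z := by
      have := mul_pos hc0 (Real.exp_pos (l * min x z))
      have := mul_nonneg hc0.le hm
      linarith [min_le_right x z]
    have harg := hA.le_delayed_arg hc0 hl hs hzs (hP0 x (φ x)).le (hPexp x (φ x))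
    have hψ := monotone_subBarrier (z := z) hl hlν harg
    have e : subBarrier l ν z (min x z - c * τ 0 - c * Real.exp (l * min x z)) =
        subExp l ν z (min x z - c * τ 0 - c * Real.exp (l * min x z)) := by
      rw [subBarrier, min_eq_left hη]
    rw [← e]
    exact hmono _ _ (subBarrier_pos hl hlν _).le
      ((subBarrier_le_exp_peak hl hlν _).trans hzu) (hψ.trans (le_max_left _ _)) (hPk _ _)
  have hsub : ∀ x, subBarrier l ν z x ≤ φ x := by
    refine subBarrier_le_of_le_source hα hβ hφ hv hφb hvb hl hlν (fun x hx => ?_) fun x hx => ?_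
    · rw [← hcαβ, ← hdαβ]
      have := hsource x
      rwa [min_eq_left hx.le] at this
    · rw [← hdαβ]
      have := hsource x
      rw [min_eq_right hx.le] at this
      exact (const_source_le_peak hl hlν c d).trans this
  -- The truncation is inactive, so the truncated equation is the original one.
  have hP : ∀ x, P x (φ x) = φ x := fun x => barrierClamp_eq (hsub x) (hup x) (hexp x)
  have harg : Continuous fun x => x - T x (φ x) :=
    continuous_id.sub (hT.comp (continuous_id.prodMk hφc))
  refine ⟨φ, l, ν, z, k, hl, hlν, ⟨?_, fun x => ?_⟩, fun x => ⟨hsub x, hup x, hexp x⟩⟩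
  · exact contDiff_two_of_factorized hφ hv (hG.comp (harg.prodMk (hφc.comp harg)))
  · have h1 : deriv φ = fun x => β * φ x + v x := funext fun x => (hφ x).deriv
    have h2 : deriv (deriv φ) x = β * (β * φ x + v x) +
        (-α * v x - G (x - T x (φ x)) (φ (x - T x (φ x)))) := by
      rw [h1]
      exact (((hφ x).const_mul β).add (hv x)).deriv
    have h3 : G (x - T x (φ x)) (φ (x - T x (φ x))) = b (φ (x - c * τ (φ x))) := by
      simp only [G, T, hP]
    rw [h2, h3, h1, hcαβ, hdαβ]
    ring

end StateDelayWave

theorem theorem3p2 (d K M : ℝ) (hd : 0 < d) (hK : 0 < K) (b τ : ℝ → ℝ)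
    (hB : StateDelayWave.IsBirthFunction d K b)
    (hA : StateDelayWave.IsDelay M τ)
    (hC : StateDelayWave.IsNonmonotoneBirth d K b)
    (c : ℝ)
    (hc : StateDelayWave.criticalSpeed d (StateDelayWave.halfDeriv b 0) (τ 0) < c) :
    ∃ φ : ℝ → ℝ,
      StateDelayWave.IsWaveProfile d b τ c φ ∧
      (∀ ξ, 0 < φ ξ) ∧
      BddAbove (Set.range φ) ∧
      Filter.Tendsto φ Filter.atBot (nhds 0) ∧
      0 < Filter.liminf φ Filter.atTop := by
  obtain ⟨φ, l, ν, z, k, hl, hlν, hwave, hφ⟩ :=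
    StateDelayWave.exists_waveProfile_between hd hK hB hA hC hc
  have hpos : ∀ ξ, 0 < φ ξ := fun ξ =>
    (StateDelayWave.subBarrier_pos hl hlν ξ).trans_le (hφ ξ).1
  refine ⟨φ, hwave, hpos, ⟨k, by rintro _ ⟨ξ, rfl⟩; exact (hφ ξ).2.1⟩, ?_, ?_⟩
  · exact squeeze_zero (fun ξ => (hpos ξ).le) (fun ξ => (hφ ξ).2.2)
      (StateDelayWave.tendsto_exp_mul_atBot hl)
  · refine (StateDelayWave.subExp_pos hl hlν (le_refl z)).trans_le
      (Filter.le_liminf_of_le ?_ ?_)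
    -- In ℝ the lower limit is a conditional supremum, so the upper bound k is needed too.
    · exact (Filter.isBoundedUnder_of ⟨k, fun ξ => (hφ ξ).2.1⟩).isCoboundedUnder_ge
    · filter_upwards [Filter.eventually_ge_atTop z] with ξ hξ
      have h := (hφ ξ).1
      rwa [StateDelayWave.subBarrier, min_eq_right hξ] at h
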